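/- Consider finite (possibly empty) sequences $(\lambda_1,\dots,\lambda_s)$ of non-negative integers (parts), where each part has one of the three colors $a$, $b$, $u$ and may be overlined or not. Call such a sequence a jagged overpartition of $n=\lambda_1+\cdots+\lambda_s$ if: only positive parts are overlined, and only the final occurrence of a given colored integer may be overlined; the last part satisfies $\lambda_s\notin\{0_a,0_b,\overline{1}_a,\overline{1}_b\}$; and for all $1\le m<s$ the difference $\lambda_m-\lambda_{m+1}$ is at least the entry, in the row of $\lambda_m$ and the column of $\lambda_{m+1}$, of the matrix $$ \overline{C}=\begin{array}{c|cccccc} & \overline a & \overline b & \overline u & a & b & u\\ \hline \overline a & 2 & 0 & 2 & 2 & 0 & 2\\ \overline b & 2 & 2 & 3 & 2 & 2 & 3\\ \overline u & 1 & 0 & 1 & 1 & 0 & 1\\ a & 1 & -1 & 1 & 1 & -1 & 1\\ b & 1 & 1 & 2 & 1 & 1 & 2\\ u & 0 & -1 & 0 & 0 & -1 & 0 \end{array} $$ For $n,k,i,j\ge 0$ let $\overline{C}_1(n;k;i,j)$ be the number of jagged overpartitions of $n$ with $k$ non-overlined parts, $i$ parts colored $a$ and $j$ parts colored $b$ that satisfy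 the following condition: if there is a $u$-colored part and the smallest $u$-colored part $x_u$ is equal to the number of overlined parts that come after $x_u$ ($x_u$ itself included), then the final part $\lambda_s$ is overlined. Each of these numbers is finite, and, as formal power series in $a,b,d,q$, $$ \sum_{n,k,i,j\ge 0}\overline{C}_1(n;k;i,j)\,a^ib^jd^kq^n=\frac{(-q)_\infty}{(dq)_\infty}\sum_{r,s\ge 0}\frac{q^{r^2+r+s^2+s-\binom{r+s+1}{2}}\,a^rb^s\,d^{r+s}(-q/d)_{r+s}}{(q^2;q^2)_r\,(q^2;q^2)_s}, $$ where $(x;q)_n=\prod_{m=0}^{n-1}(1-xq^m)$ for $n\in\mathbb{N}\cup\{\infty\}$, $(x)_n=(x;q)_n$, so that $d^{n}(-q/d)_{n}=\prod_{m=1}^{n}(d+q^m)$, and all infinite sums and products converge coefficientwise. -/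

import Mathlib

open scoped MvPowerSeries.WithPiTopology

namespace Capparelli

/-- The three colors of parts. -/
inductive Color
  | a
  | b
  | u
  deriving DecidableEq

/-- A colored part, possibly overlined. -/
structure Part where
  size : ℕ
  color : Color
  overlined : Bool
  deriving DecidableEq

/-- Matrix of minimal differences; rows and columns in the order `ā, b̄, ū, a, b, u`. -/
def diffMatrix : Matrix (Fin 6) (Fin 6) ℤ :=
  !![2,  0, 2, 2,  0, 2;
     2,  2, 3, 2,  2, 3;
     1,  0, 1, 1,  0, 1;
     1, -1, 1, 1, -1, 1;
     1,  1, 2, 1,  1, 2;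
     0, -1, 0, 0, -1, 0]

/-- Row (column) of the difference matrix that belongs to a part. -/
def Part.index (p : Part) : Fin 6 :=
  match p.overlined, p.color with
  | true, Color.a => 0
  | true, Color.b => 1
  | true, Color.u => 2
  | false, Color.a => 3
  | false, Color.b => 4
  | false, Color.u => 5

/-- Jagged overpartitions `(λ₁, …, λₛ)` in three colors (the list may be empty). -/
structure IsJagged (l : List Part) : Prop where
  /-- only positive parts may be overlined -/
  pos_of_overlined : ∀ p ∈ l, p.overlined = true → 0 < p.size
  /-- only the final occurrence of a (colored) part may be overlined -/
  final_occurrence : l.Pairwise fun p p' =>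
    p.overlined = true → ¬ (p'.size = p.size ∧ p'.color = p.color)
  /-- the last part is none of `0_a`, `0_b`, `1̄_a`, `1̄_b` -/
  last_ne : ∀ p ∈ l.getLast?,
    p ≠ ⟨0, Color.a, false⟩ ∧ p ≠ ⟨0, Color.b, false⟩ ∧
    p ≠ ⟨1, Color.a, true⟩ ∧ p ≠ ⟨1, Color.b, true⟩
  /-- successive parts satisfy `λᵢ - λᵢ₊₁ ≥` the matrix entry -/
  diff : l.IsChain fun p p' => diffMatrix p.index p'.index ≤ (p.size : ℤ) - (p'.size : ℤ)

/-- If the smallest `u`-colored part `x` equals the number of overlined parts among `x` and the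
parts after it, then the final part is overlined.
(In a jagged overpartition, if several `u`-parts have the smallest size, they all give the same
number, so that it does not matter which one is taken.) -/
def ExtraCondition (l : List Part) : Prop :=
  ∀ (l₁ : List Part) (x : Part) (l₂ : List Part), l = l₁ ++ x :: l₂ →
    x.color = Color.u → (∀ y ∈ l, y.color = Color.u → x.size ≤ y.size) →
    x.size = (x :: l₂).countP (fun p => p.overlined) →
    ∀ p ∈ l.getLast?, p.overlined = true

/-- The jagged overpartitions of `n` that satisfy the extra condition, with `k` non-overlined
parts, `i` parts colored `a` and `j` parts colored `b`. -/
def C1Set (n k i j : ℕ) : Set (List Part) :=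
  {l | IsJagged l ∧ ExtraCondition l ∧ (l.map Part.size).sum = n ∧
    l.countP (fun p => !p.overlined) = k ∧
    l.countP (fun p => p.color = Color.a) = i ∧
    l.countP (fun p => p.color = Color.b) = j}

/-- The number of elements of `C1Set n k i j`. -/
noncomputable def C1 (n k i j : ℕ) : ℕ := (C1Set n k i j).ncard

/-- The four formal variables. -/
inductive Var
  | a
  | b
  | d
  | q
  deriving DecidableEq

/-- Formal power series in the variables `a, b, d, q`, with the topology of coefficientwise
convergence. -/
abbrev Series : Type := MvPowerSeries Var ℚ

noncomputable def va : Series := MvPowerSeries.X Var.a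
noncomputable def vb : Series := MvPowerSeries.X Var.b
noncomputable def vd : Series := MvPowerSeries.X Var.d
noncomputable def vq : Series := MvPowerSeries.X Var.q

/-- `∑ C₁(n;k;i,j) a^i b^j d^k q^n`, given by its coefficients. -/
noncomputable def C1Series : Series := fun e => (C1 (e Var.q) (e Var.d) (e Var.a) (e Var.b) : ℚ)

/-- `(x; q)_n = ∏_{m < n} (1 - x q^m)`. -/
def qPoch {R : Type*} [CommRing R] (x q : R) (n : ℕ) : R :=
  ∏ m ∈ Finset.range n, (1 - x * q ^ m)

/-- `(x; q)_∞`. -/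
noncomputable def qPochInf (x q : Series) : Series :=
  ∏' m : ℕ, (1 - x * q ^ m)

/-- `d^n (x/d; q)_n`, written without denominators as `∏_{m < n} (d - x q^m)`. -/
def qPochHom {R : Type*} [CommRing R] (d x q : R) (n : ℕ) : R :=
  ∏ m ∈ Finset.range n, (d - x * q ^ m)

theorem qPochHom_eq {K : Type*} [Field K] (d x q : K) (hd : d ≠ 0) (n : ℕ) :
    qPochHom d x q n = d ^ n * qPoch (x / d) q n := by
  unfold qPochHom qPoch
  rw [← Finset.card_range n, ← Finset.prod_const, Finset.card_range, ← Finset.prod_mul_distrib]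
  refine Finset.prod_congr rfl fun m _ => ?_
  field_simp

/-- The `(r, s)` term of the double sum:
`q^(r²+r+s²+s-C(r+s+1,2)) a^r b^s d^(r+s) (-q/d)_{r+s} / ((q²;q²)_r (q²;q²)_s)`.
The exponent of `q` is never negative, so the truncated subtraction is the true one. -/
noncomputable def term (r s : ℕ) : Series :=
  vq ^ (r ^ 2 + r + s ^ 2 + s - (r + s + 1).choose 2) * va ^ r * vb ^ s *
    qPochHom vd (-vq) vq (r + s) *
    (qPoch (vq ^ 2) (vq ^ 2) r * qPoch (vq ^ 2) (vq ^ 2) s)⁻¹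

theorem choose_le_exponent (r s : ℕ) :
    (r + s + 1).choose 2 ≤ r ^ 2 + r + s ^ 2 + s := by
  rw [Nat.choose_two_right]
  apply Nat.div_le_of_le_mul
  simp only [Nat.add_sub_cancel]
  zify
  nlinarith [sq_nonneg ((r : ℤ) - s)]

end Capparelli

/-! Read a list from its last part on, and replace each size by its excess over the least size
possible for its color and overlining. The matrix collapses to one rule, `Next`: the following
excess is at least the current one, plus 1 if the current part is overlined, plus a number `step` in
{0, 1}. The condition on the last part says that it may follow a phantom non-overlined `a` of excess
0.

Fix the numbers r, s, t of parts colored a, b, u and put N = r + s + t. Let A be the generating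
function of these lists without the extra condition, and L_x that of the chains, free of the
condition on the last part, whose first part has color x and excess 0. Deleting this part expresses
L_x through A, L_a, L_b for one part fewer (`leastGF_add_single`, `gf_above_step_b`,
`gf_above_step_u`). Lowering every excess by 1 gives q^N (A + L_a) = A - L_b - L_u
(`gf_above_step_a`). These relations determine all four series by induction on N, and `closedForms`
verifies the solution; in particular A = F(r,s,t), the `closedForm`.

The premise of the extra condition becomes `Tight 0`, which forces the first excess to be 0.
Requiring tightness multiplies L_a and L_b by 1 - q^t (`tightGF_eq`), while L_u = (1 - q^t)(A - L_b)
consists of tight chains only. Discarding the tight lists with non-overlined first part leaves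
F(r,s,t) - d F(r,s,t-1). Hence the sum over t is (1 - d) ∑ F(r,s,t), which the q-binomial theorem
evaluates; the factor 1 - d turns 1/(d)_∞ into 1/(dq)_∞. -/

namespace Capparelli

/-! ### Weights and generating functions of sets of lists -/

open Finsupp (single)

/-- The monomial in `a, b` that a color contributes. -/
noncomputable def Color.weight : Color → (Var →₀ ℕ)
  | .a => single .a 1
  | .b => single .b 1
  | .u => 0

/-- The least size of a non-overlined part of a given color in a jagged overpartition. -/
def Color.offset : Color → ℕ
  | .b => 1
  | _ => 0

/-- The exponent vector of a part, where `p.size` is the excess of its size over the least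
possible one, `p.color.offset + p.overlined.toNat`. -/
noncomputable def Part.weight (p : Part) : Var →₀ ℕ :=
  single .q (p.size + p.color.offset + p.overlined.toNat) +
    (if p.overlined then 0 else single .d 1) + p.color.weight

/-- The exponent vector of a list of parts. -/
noncomputable def weight (l : List Part) : Var →₀ ℕ := (l.map Part.weight).sum

@[simp] theorem weight_nil : weight [] = 0 := rfl

@[simp] theorem weight_cons (p : Part) (l : List Part) :
    weight (p :: l) = p.weight + weight l := by
  simp [weight]

theorem Color.weight_q (x : Color) : x.weight .q = 0 := by
  cases x <;> simp [Color.weight]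

theorem Color.weight_d (x : Color) : x.weight .d = 0 := by
  cases x <;> simp [Color.weight]

theorem Part.weight_q (p : Part) :
    p.weight .q = p.size + p.color.offset + p.overlined.toNat := by
  rcases p with ⟨n, x, o⟩
  cases o <;> simp [Part.weight, Color.weight_q]

theorem Part.weight_d (p : Part) : p.weight .d = (!p.overlined).toNat := by
  rcases p with ⟨n, x, o⟩
  cases o <;> simp [Part.weight, Color.weight_d]

/-- A non-overlined part contributes a factor d and an overlined one at least a factor q. So a
weight bounds the number of parts, and only finitely many lists share it. -/
theorem length_le_weight (l : List Part) : l.length ≤ weight l .d + weight l .q := by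
  induction l with
  | nil => simp
  | cons p l ih =>
    have : 1 ≤ p.weight .d + p.weight .q := by
      rw [Part.weight_d, Part.weight_q]
      cases p.overlined <;> simp
    simp only [List.length_cons, weight_cons, Finsupp.add_apply]
    omega

theorem size_le_weight (l : List Part) : ∀ p ∈ l, p.size ≤ weight l .q := by
  induction l with
  | nil => simp
  | cons p l ih =>
    intro p' hp'
    have h := p.weight_q
    simp only [weight_cons, Finsupp.add_apply]
    rcases List.mem_cons.1 hp' with rfl | hp'
    · omega
    · have := ih p' hp'
      omega

theorem finite_size_le (n : ℕ) : {p : Part | p.size ≤ n}.Finite := by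
  have hC : (Set.univ : Set Color).Finite :=
    Set.Finite.subset (Set.toFinite {Color.a, Color.b, Color.u}) (by rintro (_ | _ | _) <;> simp)
  refine (((Set.finite_Iic n).prod (hC.prod (Set.finite_univ (α := Bool)))).image
    fun x : ℕ × Color × Bool => Part.mk x.1 x.2.1 x.2.2).subset ?_
  rintro ⟨m, x, o⟩ hm
  exact ⟨(m, x, o), ⟨hm, trivial, trivial⟩, rfl⟩

theorem finite_weight_eq (e : Var →₀ ℕ) : {l : List Part | weight l = e}.Finite := by
  have hfin := finite_size_le (e .q)
  have : Finite {p : Part // p.size ≤ e .q} := hfin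
  refine ((List.finite_length_le {p : Part // p.size ≤ e .q} (e .d + e .q)).image
    (List.map Subtype.val)).subset ?_
  rintro l rfl
  lift l to List {p : Part // p.size ≤ weight l .q} using size_le_weight l with l' hl
  refine ⟨l', ?_, rfl⟩
  have := length_le_weight (l'.map Subtype.val)
  simpa using this

/-- The generating function of a set of lists of parts. -/
noncomputable def gf (S : Set (List Part)) : Series :=
  fun e => (({l ∈ S | weight l = e}.ncard : ℕ) : ℚ)

theorem coeff_gf (S : Set (List Part)) (e : Var →₀ ℕ) :
    MvPowerSeries.coeff e (gf S) = ({l ∈ S | weight l = e}.ncard : ℕ) := rfl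

theorem finite_fiber (S : Set (List Part)) (e : Var →₀ ℕ) : {l ∈ S | weight l = e}.Finite :=
  (finite_weight_eq e).subset fun _ h => h.2

theorem gf_eq_add {S A B : Set (List Part)} (h : ∀ l, l ∈ S ↔ l ∈ A ∨ l ∈ B)
    (hd : ∀ l ∈ A, l ∉ B) : gf S = gf A + gf B := by
  ext e
  rw [map_add, coeff_gf, coeff_gf, coeff_gf, ← Nat.cast_add, ← Set.ncard_union_eq _
    (finite_fiber A e) (finite_fiber B e)]
  · congr 2
    ext l
    have := h l
    simp only [Set.mem_ofPred_eq, Set.mem_union]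
    tauto
  · exact Set.disjoint_left.2 fun l hA hB => hd l hA.1 hB.1

theorem gf_empty : gf ∅ = 0 := by
  ext e
  simp [coeff_gf]

theorem gf_image {S : Set (List Part)} {f : List Part → List Part} (hf : Function.Injective f)
    (w : Var →₀ ℕ) (h : ∀ l ∈ S, weight (f l) = w + weight l) :
    gf (f '' S) = MvPowerSeries.monomial w 1 * gf S := by
  ext e
  rw [MvPowerSeries.coeff_monomial_mul, one_mul, coeff_gf]
  split_ifs with hw
  · rw [coeff_gf, ← Set.ncard_image_of_injective {l ∈ S | weight l = e - w} hf]
    congr 2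
    ext l
    constructor
    · rintro ⟨⟨l, hl, rfl⟩, rfl⟩
      exact ⟨l, ⟨hl, by rw [h l hl, add_tsub_cancel_left]⟩, rfl⟩
    · rintro ⟨l, ⟨hl, he⟩, rfl⟩
      exact ⟨⟨l, hl, rfl⟩, by rw [h l hl, he, add_tsub_cancel_of_le hw]⟩
  · rw [Nat.cast_eq_zero, Set.ncard_eq_zero (finite_fiber _ e), Set.eq_empty_iff_forall_notMem]
    rintro _ ⟨⟨l, hl, rfl⟩, rfl⟩
    exact hw (by rw [h l hl]; exact le_self_add)

theorem gf_singleton_nil : gf {[]} = 1 := by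
  ext e
  rw [coeff_gf, MvPowerSeries.coeff_one]
  split_ifs with he
  · subst he
    rw [show {l ∈ ({[]} : Set (List Part)) | weight l = 0} = {[]} by
      ext l; simp +contextual]
    simp
  · rw [Nat.cast_eq_zero, Set.ncard_eq_zero (finite_fiber _ e), Set.eq_empty_iff_forall_notMem]
    rintro l ⟨rfl, h⟩
    exact he h.symm

end Capparelli

/-! ### Chains of excesses with prescribed color counts, and their recurrences -/

namespace Capparelli

open Finsupp (single)

/-- `step x y` is the least increase of the excess from a part of color `x` to the part of
color `y` that precedes it. -/
def step : Color → Color → ℕ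
  | .a, .a => 1
  | .b, .b => 1
  | .u, .a => 1
  | .u, .b => 1
  | _, _ => 0

/-- The difference condition in terms of excesses; the list is read from its last part on. -/
def Next (x y : Part) : Prop :=
  x.size + x.overlined.toNat + step x.color y.color ≤ y.size

/-- Reversed jagged overpartitions without the condition on the last part, with parts described
by their excesses and `c x` parts of color `x`. -/
def chains (c : Color → ℕ) : Set (List Part) :=
  {l | l.IsChain Next ∧ ∀ x, l.countP (fun p => p.color = x) = c x}

/-- The chains whose first part has excess at least `κ x`, where `x` is its color. -/
def above (κ : Color → ℕ) (c : Color → ℕ) : Set (List Part) :=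
  {l ∈ chains c | ∀ p ∈ l.head?, κ p.color ≤ p.size}

/-- The chains that start with a given part. -/
def startingWith (p : Part) (c : Color → ℕ) : Set (List Part) :=
  {l ∈ chains c | l.head? = some p}

/-- The number of parts of all colors. -/
def total (c : Color → ℕ) : ℕ := c .a + c .b + c .u

theorem length_eq_countP (l : List Part) :
    l.length = l.countP (fun p => p.color = .a) + l.countP (fun p => p.color = .b) +
      l.countP (fun p => p.color = .u) := by
  induction l with
  | nil => simp
  | cons p l ih =>
    rcases p with ⟨n, x, o⟩
    cases x <;> simp [ih] <;> omega

theorem length_of_mem_chains {c : Color → ℕ} {l : List Part} (h : l ∈ chains c) :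
    l.length = total c := by
  rw [length_eq_countP, h.2, h.2, h.2, total]

/-- Without `step` the rule is transitive; in particular the first excess of a chain is the
smallest. -/
theorem pairwise_of_isChain {l : List Part} (h : l.IsChain Next) :
    l.Pairwise fun x y => x.size + x.overlined.toNat ≤ y.size := by
  have : IsTrans Part fun x y => x.size + x.overlined.toNat ≤ y.size :=
    ⟨fun x y z h₁ h₂ => by omega⟩
  refine List.isChain_iff_pairwise.1 (h.imp fun x y hxy => ?_)
  unfold Next at hxy
  omega

/-- Increase all excesses by one. -/
def shift (l : List Part) : List Part := l.map fun p => { p with size := p.size + 1 }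

theorem shift_injective : Function.Injective shift := by
  refine List.map_injective_iff.2 ?_
  rintro ⟨n, x, o⟩ ⟨n', x', o'⟩ h
  simp_all

theorem weight_shift (l : List Part) : weight (shift l) = single .q l.length + weight l := by
  induction l with
  | nil => simp [shift]
  | cons p l ih =>
    have : shift (p :: l) = { p with size := p.size + 1 } :: shift l := rfl
    rw [this, weight_cons, weight_cons, ih]
    ext v
    simp only [Part.weight, List.length_cons, Finsupp.add_apply, Finsupp.single_apply]
    split_ifs <;> omega

theorem shift_mem_chains {c : Color → ℕ} {l : List Part} : shift l ∈ chains c ↔ l ∈ chains c := by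
  have h₁ : (shift l).IsChain Next ↔ l.IsChain Next := by
    rw [shift, List.isChain_map]
    have : ∀ x y : Part, Next { x with size := x.size + 1 } { y with size := y.size + 1 } ↔
        Next x y := fun x y => by
      unfold Next
      simp only
      omega
    simp only [this]
  have h₂ : ∀ x, (shift l).countP (fun p => p.color = x) = l.countP (fun p => p.color = x) :=
    fun x => by rw [shift, List.countP_map]; rfl
  unfold chains
  simp only [Set.mem_ofPred_eq, h₁, h₂]

theorem exists_shift_eq {l : List Part} (h : ∀ p ∈ l, 1 ≤ p.size) : ∃ l', shift l' = l := by
  refine ⟨l.map fun p => { p with size := p.size - 1 }, ?_⟩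
  rw [shift, List.map_map]
  refine (List.map_congr_left fun p hp => ?_).trans (List.map_id l)
  have := h p hp
  rcases p with ⟨n, x, o⟩
  simp only [Function.comp, id, Part.mk.injEq, and_true]
  exact Nat.sub_add_cancel this

theorem shift_mem_above {κ c : Color → ℕ} {l : List Part} :
    shift l ∈ above (fun x => κ x + 1) c ↔ l ∈ above κ c := by
  refine and_congr shift_mem_chains ?_
  cases l with
  | nil => simp [shift]
  | cons p l => simp [shift]

theorem above_succ (κ c : Color → ℕ) :
    above (fun x => κ x + 1) c = shift '' above κ c := by
  ext l
  constructor
  · intro hl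
    obtain ⟨l', rfl⟩ : ∃ l', shift l' = l := by
      apply exists_shift_eq
      cases l with
      | nil => simp
      | cons p l =>
        have hp : κ p.color + 1 ≤ p.size := hl.2 p rfl
        intro p' hp'
        rcases List.mem_cons.1 hp' with rfl | hp'
        · omega
        · have := List.rel_of_pairwise_cons (pairwise_of_isChain hl.1.1) hp'
          omega
    exact ⟨l', shift_mem_above.1 hl, rfl⟩
  · rintro ⟨l', hl', rfl⟩
    exact shift_mem_above.2 hl'

theorem gf_shift {S : Set (List Part)} {c : Color → ℕ} (h : S ⊆ chains c) :
    gf (shift '' S) = vq ^ total c * gf S := by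
  rw [gf_image shift_injective (single .q (total c))]
  · rw [vq, MvPowerSeries.X_pow_eq]
  · intro l hl
    rw [weight_shift, length_of_mem_chains (h hl)]

/-- A first part of excess 0 acts on the rest only as a threshold. Overlining raises this threshold
by 1 for every color, which amounts to a `shift`. -/
theorem cons_mem_chains {c : Color → ℕ} {x : Color} {o : Bool} {l : List Part} :
    (⟨0, x, o⟩ :: l) ∈ chains (c + Pi.single x 1) ↔
      l ∈ above (fun y => step x y + o.toNat) c := by
  unfold above chains
  simp only [Set.mem_ofPred_eq, List.isChain_cons, List.countP_cons]
  have h₁ : ∀ y : Part, Next ⟨0, x, o⟩ y ↔ step x y.color + o.toNat ≤ y.size := fun y => by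
    unfold Next
    simp only
    omega
  have h₂ : (∀ y, (l.countP (fun p => p.color = y) + if decide (x = y) = true then 1 else 0) =
      (c + Pi.single x 1 : Color → ℕ) y) ↔ ∀ y, l.countP (fun p => p.color = y) = c y := by
    refine forall_congr' fun y => ?_
    by_cases hxy : x = y
    · subst hxy
      simp
    · simp [hxy, Ne.symm hxy]
  simp only [h₁]
  rw [h₂]
  tauto

/-- The monomial contributed by a color. -/
noncomputable def colorTerm (x : Color) : Series :=
  MvPowerSeries.monomial (single .q x.offset + x.weight) 1

theorem colorTerm_a : colorTerm .a = va := by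
  simp [colorTerm, Color.offset, Color.weight, va, MvPowerSeries.X]

theorem colorTerm_b : colorTerm .b = vq * vb := by
  simp [colorTerm, Color.offset, Color.weight, vb, vq, MvPowerSeries.X,
    MvPowerSeries.monomial_mul_monomial]

theorem colorTerm_u : colorTerm .u = 1 := by
  simp [colorTerm, Color.offset, Color.weight]

/-- Placing a non-overlined part of least size at the end of the members of `S`. -/
def consPlain (x : Color) (S : Set (List Part)) : Set (List Part) :=
  (fun l => ⟨0, x, false⟩ :: l) '' S

/-- Placing an overlined part of least size at the end of the members of `S`. -/
def consOver (x : Color) (S : Set (List Part)) : Set (List Part) :=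
  (fun l => ⟨0, x, true⟩ :: l) '' (shift '' S)

theorem gf_consPlain (x : Color) (S : Set (List Part)) :
    gf (consPlain x S) = vd * colorTerm x * gf S := by
  rw [consPlain, gf_image List.cons_injective (single .d 1 + (single .q x.offset + x.weight))]
  · rw [vd, colorTerm, MvPowerSeries.X, MvPowerSeries.monomial_mul_monomial, one_mul]
  · intro l _
    rw [weight_cons]
    simp only [Part.weight, Bool.toNat_false]
    ext v
    simp
    omega

theorem gf_consOver (x : Color) {S : Set (List Part)} {c : Color → ℕ} (h : S ⊆ chains c) :
    gf (consOver x S) = vq ^ (total c + 1) * colorTerm x * gf S := by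
  rw [consOver, gf_image List.cons_injective (single .q 1 + (single .q x.offset + x.weight)),
    gf_shift h]
  · rw [vq, colorTerm, pow_succ', MvPowerSeries.X_pow_eq, MvPowerSeries.X, mul_comm _
      (MvPowerSeries.monomial (single Var.q (total c)) (1 : ℚ)), mul_assoc
      (MvPowerSeries.monomial (single Var.q (total c)) (1 : ℚ)),
      MvPowerSeries.monomial_mul_monomial, one_mul]
    ring
  · intro l _
    rw [weight_cons]
    simp only [Part.weight, Bool.toNat_true]
    ext v
    simp [Finsupp.single_apply]
    split_ifs <;> omega

theorem startingWith_plain (x : Color) (c : Color → ℕ) :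
    startingWith ⟨0, x, false⟩ (c + Pi.single x 1) = consPlain x (above (step x) c) := by
  ext l
  constructor
  · rintro ⟨hl, hp⟩
    obtain ⟨l', rfl⟩ := List.head?_eq_some_iff.1 hp
    exact ⟨l', cons_mem_chains.1 hl, rfl⟩
  · rintro ⟨l', hl', rfl⟩
    exact ⟨cons_mem_chains.2 hl', rfl⟩

theorem startingWith_over (x : Color) (c : Color → ℕ) :
    startingWith ⟨0, x, true⟩ (c + Pi.single x 1) = consOver x (above (step x) c) := by
  rw [consOver, ← above_succ]
  ext l
  constructor
  · rintro ⟨hl, hp⟩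
    obtain ⟨l', rfl⟩ := List.head?_eq_some_iff.1 hp
    exact ⟨l', cons_mem_chains.1 hl, rfl⟩
  · rintro ⟨l', hl', rfl⟩
    exact ⟨cons_mem_chains.2 hl', rfl⟩

/-- The generating function of the chains whose first part has color `x` and the least size. -/
noncomputable def leastGF (x : Color) (c : Color → ℕ) : Series :=
  gf (startingWith ⟨0, x, false⟩ c) + gf (startingWith ⟨0, x, true⟩ c)

theorem startingWith_eq_empty {p : Part} {c : Color → ℕ} (h : c p.color = 0) :
    startingWith p c = ∅ := by
  rw [Set.eq_empty_iff_forall_notMem]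
  rintro l ⟨hl, hp⟩
  obtain ⟨l', rfl⟩ := List.head?_eq_some_iff.1 hp
  have := hl.2 p.color
  rw [h, List.countP_cons] at this
  simp at this

theorem leastGF_eq_zero {x : Color} {c : Color → ℕ} (h : c x = 0) : leastGF x c = 0 := by
  rw [leastGF, startingWith_eq_empty (p := ⟨0, x, false⟩) h,
    startingWith_eq_empty (p := ⟨0, x, true⟩) h, gf_empty, add_zero]

/-- The deleted part is either plain, with factor d, or overlined: then it costs one q itself and
one more for each of the `total c` parts that it pushes up. -/
theorem leastGF_add_single (x : Color) (c : Color → ℕ) :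
    leastGF x (c + Pi.single x 1) =
      (vd + vq ^ (total c + 1)) * colorTerm x * gf (above (step x) c) := by
  rw [leastGF, startingWith_plain, startingWith_over, gf_consPlain,
    gf_consOver x (c := c) fun _ h => h.1]
  ring

/-- Splitting off the chains whose first part has color `x` and the least size. -/
theorem gf_above_eq_add (κ κ' : Color → ℕ) (x : Color) (c : Color → ℕ) (hx : κ x = 0)
    (hx' : κ' x = 1) (h : ∀ y, y ≠ x → κ y = κ' y) :
    gf (above κ c) = gf (above κ' c) + leastGF x c := by
  rw [leastGF, ← gf_eq_add (S := {l ∈ chains c | ∃ o, l.head? = some ⟨0, x, o⟩})]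
  · apply gf_eq_add
    · intro l
      rcases l with _ | ⟨⟨n, y, o⟩, l⟩
      · simp [above]
      · by_cases hy : y = x
        · subst hy
          rcases n with _ | n <;> cases o <;> simp [above, hx, hx']
        · simp [above, h y hy, hy]
    · rintro l ⟨_, hl⟩ ⟨_, o, ho⟩
      have := hl _ ho
      simp [hx'] at this
  · intro l
    constructor
    · rintro ⟨hl, o, ho⟩
      cases o
      · exact Or.inl ⟨hl, ho⟩
      · exact Or.inr ⟨hl, ho⟩
    · rintro (⟨hl, ho⟩ | ⟨hl, ho⟩)
      · exact ⟨hl, _, ho⟩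
      · exact ⟨hl, _, ho⟩
  · rintro l ⟨_, h₁⟩ ⟨_, h₂⟩
    simp [h₁] at h₂

/-- Adding the first parts excluded by either threshold gives the same set, all chains. -/
theorem gf_above_step_b (c : Color → ℕ) :
    gf (above (step .b) c) = gf (above (step .a) c) + leastGF .a c - leastGF .b c := by
  have h₁ := gf_above_eq_add (fun _ => 0) (step .a) .a c rfl rfl
    (by rintro (_ | _ | _) <;> simp [step])
  have h₂ := gf_above_eq_add (fun _ => 0) (step .b) .b c rfl rfl
    (by rintro (_ | _ | _) <;> simp [step])
  linear_combination h₁ - h₂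

theorem gf_above_step_u (c : Color → ℕ) :
    gf (above (step .u) c) = gf (above (step .a) c) - leastGF .b c := by
  have h₁ := gf_above_eq_add (step .a) (step .u) .b c rfl rfl
    (by rintro (_ | _ | _) <;> simp [step])
  linear_combination -h₁

/-- Removing one from all parts. -/
theorem gf_above_step_a (c : Color → ℕ) :
    vq ^ total c * (gf (above (step .a) c) + leastGF .a c) =
      gf (above (step .a) c) - leastGF .b c - leastGF .u c := by
  have h₁ := gf_above_eq_add (fun _ => 0) (step .a) .a c rfl rfl
    (by rintro (_ | _ | _) <;> simp [step])
  -- `step .u` already demands a positive excess for `a` and `b`, so only a first `u` of excess 0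
  -- separates it from the constant threshold 1, where every excess can be lowered.
  have h₂ := gf_above_eq_add (step .u) (fun _ => 1) .u c rfl rfl
    (by rintro (_ | _ | _) <;> simp [step])
  have h₃ : gf (above (fun _ => 1) c) = vq ^ total c * gf (above (fun _ => 0) c) := by
    rw [← gf_shift (c := c) (fun _ h => h.1), ← above_succ]
  have h₄ := gf_above_step_u c
  linear_combination h₄ - h₃ - h₂ - vq ^ total c * h₁

end Capparelli

/-! ### Tight chains and the extra condition -/

namespace Capparelli

/-- The first part of color `u` in the list has excess `m` plus the number of overlined parts
before it. For `m = 0` this says that its size is the number of overlined parts up to it. -/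
def Tight : ℕ → List Part → Prop
  | _, [] => False
  | m, p :: l => if p.color = .u then p.size = m else Tight (m + p.overlined.toNat) l

/-- Along a chain the excess grows at least as fast as the number of overlined parts passed, so a
lead over `m` is never lost. -/
theorem not_tight_of_lt {m : ℕ} {p : Part} {l : List Part} (h : (p :: l).IsChain Next)
    (hp : m < p.size) : ¬ Tight m (p :: l) := by
  induction l generalizing m p with
  | nil =>
    simp only [Tight]
    split_ifs
    · omega
    · exact id
  | cons p' l ih =>
    rw [Tight]
    split_ifs
    · omega
    · rw [List.isChain_cons_cons] at h
      refine ih h.2 ?_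
      have := h.1
      unfold Next at this
      omega

theorem tight_shift {m : ℕ} {l : List Part} : Tight (m + 1) (shift l) ↔ Tight m l := by
  induction l generalizing m with
  | nil => simp [shift, Tight]
  | cons p l ih =>
    have : shift (p :: l) = { p with size := p.size + 1 } :: shift l := rfl
    rw [this, Tight, Tight]
    split_ifs
    · simp
    · rw [← ih]
      simp only [add_right_comm]

/-- The tight members of `above κ c`. -/
def tightAbove (κ c : Color → ℕ) : Set (List Part) := {l ∈ above κ c | Tight 0 l}

/-- The tight members of `startingWith p c`. -/
def tightStarting (p : Part) (c : Color → ℕ) : Set (List Part) :=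
  {l ∈ startingWith p c | Tight 0 l}

/-- The generating function of the tight chains whose first part has color `x`. -/
noncomputable def tightGF (x : Color) (c : Color → ℕ) : Series :=
  gf (tightStarting ⟨0, x, false⟩ c) + gf (tightStarting ⟨0, x, true⟩ c)

theorem tightStarting_u (o : Bool) (c : Color → ℕ) :
    tightStarting ⟨0, .u, o⟩ c = startingWith ⟨0, .u, o⟩ c := by
  ext l
  refine ⟨fun h => h.1, fun h => ⟨h, ?_⟩⟩
  obtain ⟨l', rfl⟩ := List.head?_eq_some_iff.1 h.2
  simp [Tight]

theorem tightGF_u (c : Color → ℕ) : tightGF .u c = leastGF .u c := by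
  rw [tightGF, tightStarting_u, tightStarting_u, leastGF]

theorem tightStarting_plain {x : Color} (hx : x ≠ .u) (c : Color → ℕ) :
    tightStarting ⟨0, x, false⟩ (c + Pi.single x 1) = consPlain x (tightAbove (step x) c) := by
  ext l
  rw [tightStarting, startingWith_plain]
  constructor
  · rintro ⟨⟨l', hl', rfl⟩, ht⟩
    exact ⟨l', ⟨hl', by simpa [Tight, hx] using ht⟩, rfl⟩
  · rintro ⟨l', ⟨hl', ht⟩, rfl⟩
    exact ⟨⟨l', hl', rfl⟩, by simpa [Tight, hx] using ht⟩

theorem tightStarting_over {x : Color} (hx : x ≠ .u) (c : Color → ℕ) :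
    tightStarting ⟨0, x, true⟩ (c + Pi.single x 1) = consOver x (tightAbove (step x) c) := by
  ext l
  rw [tightStarting, startingWith_over]
  constructor
  · rintro ⟨⟨_, ⟨l', hl', rfl⟩, rfl⟩, ht⟩
    exact ⟨_, ⟨l', ⟨hl', tight_shift.1 (by simpa [Tight, hx] using ht)⟩, rfl⟩, rfl⟩
  · rintro ⟨_, ⟨l', ⟨hl', ht⟩, rfl⟩, rfl⟩
    exact ⟨⟨_, ⟨l', hl', rfl⟩, rfl⟩, by simpa [Tight, hx] using tight_shift.2 ht⟩

theorem tightStarting_eq_empty {p : Part} {c : Color → ℕ} (h : c p.color = 0) :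
    tightStarting p c = ∅ := by
  rw [tightStarting, startingWith_eq_empty h]
  simp

theorem tightGF_eq_zero {x : Color} {c : Color → ℕ} (h : c x = 0) : tightGF x c = 0 := by
  rw [tightGF, tightStarting_eq_empty (p := ⟨0, x, false⟩) h,
    tightStarting_eq_empty (p := ⟨0, x, true⟩) h, gf_empty, add_zero]

theorem tightGF_add_single {x : Color} (hx : x ≠ .u) (c : Color → ℕ) :
    tightGF x (c + Pi.single x 1) =
      (vd + vq ^ (total c + 1)) * colorTerm x * gf (tightAbove (step x) c) := by
  rw [tightGF, tightStarting_plain hx, tightStarting_over hx, gf_consPlain,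
    gf_consOver x (c := c) fun _ h => h.1.1]
  ring

theorem head_of_tight {l : List Part} (hl : l.IsChain Next) (ht : Tight 0 l) :
    ∃ x o, l.head? = some ⟨0, x, o⟩ := by
  rcases l with _ | ⟨⟨n, x, o⟩, l⟩
  · exact ht.elim
  · rcases n with _ | n
    · exact ⟨x, o, rfl⟩
    · exact absurd ht (not_tight_of_lt hl (Nat.succ_pos n))

theorem gf_tight_head_eq (x : Color) (c : Color → ℕ) :
    gf {l ∈ chains c | (∃ o, l.head? = some ⟨0, x, o⟩) ∧ Tight 0 l} = tightGF x c := by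
  rw [tightGF]
  apply gf_eq_add
  · intro l
    constructor
    · rintro ⟨hl, ⟨o, ho⟩, ht⟩
      cases o
      · exact Or.inl ⟨⟨hl, ho⟩, ht⟩
      · exact Or.inr ⟨⟨hl, ho⟩, ht⟩
    · rintro (⟨⟨hl, ho⟩, ht⟩ | ⟨⟨hl, ho⟩, ht⟩)
      · exact ⟨hl, ⟨_, ho⟩, ht⟩
      · exact ⟨hl, ⟨_, ho⟩, ht⟩
  · rintro l ⟨⟨_, h₁⟩, _⟩ ⟨⟨_, h₂⟩, _⟩
    simp [h₁] at h₂

/-- A tight chain starts with excess 0, and the threshold `step x` forbids this for the color `x`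
alone. -/
theorem gf_tightAbove (x y : Color) (hx : step x x = 1) (hy : step x y = 0) (hu : step x .u = 0)
    (hyu : y ≠ .u) (hxy : ∀ z, z = x ∨ z = y ∨ z = .u) (c : Color → ℕ) :
    gf (tightAbove (step x) c) = tightGF y c + leastGF .u c := by
  rw [← tightGF_u, ← gf_tight_head_eq y, ← gf_tight_head_eq .u]
  apply gf_eq_add
  · intro l
    constructor
    · rintro ⟨hl, ht⟩
      obtain ⟨z, o, ho⟩ := head_of_tight hl.1.1 ht
      have hz := hl.2 _ ho
      rcases hxy z with rfl | rfl | rfl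
      · simp [hx] at hz
      · exact Or.inl ⟨hl.1, ⟨o, ho⟩, ht⟩
      · exact Or.inr ⟨hl.1, ⟨o, ho⟩, ht⟩
    · rintro (⟨hl, ⟨o, ho⟩, ht⟩ | ⟨hl, ⟨o, ho⟩, ht⟩)
      · exact ⟨⟨hl, fun p hp => by
          obtain rfl := Option.some.inj (ho.symm.trans hp)
          exact hy.le⟩, ht⟩
      · exact ⟨⟨hl, fun p hp => by
          obtain rfl := Option.some.inj (ho.symm.trans hp)
          exact hu.le⟩, ht⟩
  · rintro l ⟨_, ⟨o, h₁⟩, _⟩ ⟨_, ⟨o', h₂⟩, _⟩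
    simp [h₁, hyu] at h₂

theorem gf_tightAbove_a (c : Color → ℕ) :
    gf (tightAbove (step .a) c) = tightGF .b c + leastGF .u c :=
  gf_tightAbove .a .b rfl rfl rfl (by simp) (by rintro (_ | _ | _) <;> simp) c

theorem gf_tightAbove_b (c : Color → ℕ) :
    gf (tightAbove (step .b) c) = tightGF .a c + leastGF .u c :=
  gf_tightAbove .b .a rfl rfl rfl (by simp) (by rintro (_ | _ | _) <;> simp) c

/-- The chains that correspond to the overpartitions to be counted. -/
def admissible (c : Color → ℕ) : Set (List Part) :=
  {l ∈ above (step .a) c | Tight 0 l → ∀ p ∈ l.head?, p.overlined = true}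

theorem gf_above_eq_admissible_add (c : Color → ℕ) :
    gf (above (step .a) c) = gf (admissible c) +
      (gf (tightStarting ⟨0, .b, false⟩ c) + gf (tightStarting ⟨0, .u, false⟩ c)) := by
  rw [← gf_eq_add (S := {l ∈ above (step .a) c | Tight 0 l ∧ ∀ p ∈ l.head?, p.overlined = false})]
  · apply gf_eq_add
    · intro l
      rcases l with _ | ⟨p, l⟩
      · simp [admissible, Tight]
      · simp only [admissible, Set.mem_ofPred_eq, List.head?_cons, Option.mem_some_iff,
          forall_eq']
        grind
    · rintro l ⟨_, h₁⟩ ⟨hl, ht, h₂⟩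
      obtain ⟨z, o, ho⟩ := head_of_tight hl.1.1 ht
      have := h₁ ht _ ho
      rw [h₂ _ ho] at this
      simp at this
  · intro l
    constructor
    · rintro ⟨hl, ht, h₂⟩
      obtain ⟨z, o, ho⟩ := head_of_tight hl.1.1 ht
      obtain rfl : o = false := h₂ _ ho
      have hz := hl.2 _ ho
      cases z
      · simp [step] at hz
      · exact Or.inl ⟨⟨hl.1, ho⟩, ht⟩
      · exact Or.inr ⟨⟨hl.1, ho⟩, ht⟩
    · rintro (⟨⟨hl, ho⟩, ht⟩ | ⟨⟨hl, ho⟩, ht⟩)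
      · exact ⟨⟨hl, fun p hp => by
          obtain rfl := Option.some.inj (ho.symm.trans hp)
          exact le_rfl⟩, ht, fun p hp => by
          obtain rfl := Option.some.inj (ho.symm.trans hp)
          rfl⟩
      · exact ⟨⟨hl, fun p hp => by
          obtain rfl := Option.some.inj (ho.symm.trans hp)
          exact le_rfl⟩, ht, fun p hp => by
          obtain rfl := Option.some.inj (ho.symm.trans hp)
          rfl⟩
  · rintro l ⟨⟨_, h₁⟩, _⟩ ⟨⟨_, h₂⟩, _⟩
    simp [h₁] at h₂

theorem eq_zero_or_eq_add_single (c : Color → ℕ) (x : Color) :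
    c x = 0 ∨ ∃ c' : Color → ℕ, c = c' + Pi.single x 1 := by
  rcases Nat.eq_zero_or_pos (c x) with h | h
  · exact Or.inl h
  · refine Or.inr ⟨c - Pi.single x 1, funext fun y => ?_⟩
    by_cases hy : y = x
    · subst hy
      simp only [Pi.add_apply, Pi.sub_apply, Pi.single_eq_same]
      omega
    · simp [hy]

theorem total_add_single (c : Color → ℕ) (x : Color) :
    total (c + Pi.single x 1) = total c + 1 := by
  cases x <;> simp [total] <;> omega

/-- Plain and overlined first parts contribute in the ratio d : q^N, since the admissible remainders
agree up to a shift and shifting by N + 1 preserves tightness only through this same correspondence.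
-/
theorem gf_tightStarting_plain (x : Color) (c : Color → ℕ) :
    (vd + vq ^ total c) * gf (tightStarting ⟨0, x, false⟩ c) = vd * tightGF x c := by
  rcases eq_zero_or_eq_add_single c x with h | ⟨c, rfl⟩
  · rw [tightGF_eq_zero h, tightStarting_eq_empty (p := ⟨0, x, false⟩) h, gf_empty, mul_zero,
      mul_zero]
  · rw [total_add_single]
    by_cases hx : x = .u
    · subst hx
      rw [tightGF_u, leastGF_add_single, tightStarting_u, startingWith_plain, gf_consPlain]
      ring
    · rw [tightGF_add_single hx, tightStarting_plain hx, gf_consPlain]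
      ring

end Capparelli

/-! ### Solving the recurrences in closed form -/

namespace Capparelli

open MvPowerSeries (constantCoeff)

theorem constantCoeff_vq : constantCoeff vq = 0 := MvPowerSeries.constantCoeff_X _

theorem constantCoeff_vd : constantCoeff vd = 0 := MvPowerSeries.constantCoeff_X _

theorem qPoch_succ {R : Type*} [CommRing R] (x q : R) (n : ℕ) :
    qPoch x q (n + 1) = qPoch x q n * (1 - x * q ^ n) := Finset.prod_range_succ _ _

theorem qPochHom_succ {R : Type*} [CommRing R] (d x q : R) (n : ℕ) :
    qPochHom d x q (n + 1) = qPochHom d x q n * (d - x * q ^ n) := Finset.prod_range_succ _ _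

theorem constantCoeff_qPoch {x : Series} (hx : constantCoeff x = 0) (q : Series) (n : ℕ) :
    constantCoeff (qPoch x q n) = 1 := by
  simp [qPoch, map_prod, hx]

theorem one_sub_mul_inv_qPoch_succ {x : Series} (hx : constantCoeff x = 0) (q : Series) (n : ℕ) :
    (1 - x * q ^ n) * (qPoch x q (n + 1))⁻¹ = (qPoch x q n)⁻¹ := by
  have h₁ := MvPowerSeries.mul_inv_cancel (qPoch x q n)
    (by rw [constantCoeff_qPoch hx]; exact one_ne_zero)
  have h₂ := MvPowerSeries.mul_inv_cancel (qPoch x q (n + 1))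
    (by rw [constantCoeff_qPoch hx]; exact one_ne_zero)
  rw [qPoch_succ] at h₂
  rw [qPoch_succ]
  linear_combination (qPoch x q n)⁻¹ * h₂ - (1 - x * q ^ n) *
    (qPoch x q n * (1 - x * q ^ n))⁻¹ * h₁

/-- The exponent of `q` in the double sum. -/
def expo (r s : ℕ) : ℕ := r ^ 2 + r + s ^ 2 + s - (r + s + 1).choose 2

theorem expo_comm (r s : ℕ) : expo r s = expo s r := by
  unfold expo
  rw [add_comm r s]
  congr 1
  ring

/-- The increment r + 1 - s may be negative; this is also why powers of q appear on both sides of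
`closedForm_succ_a` and of `ClosedForms.least_a`. -/
theorem expo_succ (r s : ℕ) : expo (r + 1) s + s = expo r s + (r + 1) := by
  have h₁ := choose_le_exponent r s
  have h₂ := choose_le_exponent (r + 1) s
  have h₃ : (r + 1 + s + 1).choose 2 = (r + s + 1).choose 2 + (r + s + 1) := by
    rw [show r + 1 + s + 1 = (r + s + 1) + 1 by ring, Nat.choose_succ_succ' _ 1, Nat.choose_one_right]
    ring
  unfold expo
  zify [h₁, h₂]
  rw [h₃]
  push_cast
  ring

/-- The common factor of the generating functions with `r`, `s`, `t` parts of color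
`a`, `b`, `u`. -/
noncomputable def closedForm (r s t : ℕ) : Series :=
  vq ^ expo r s * va ^ r * vb ^ s * qPochHom vd (-vq) vq (r + s + t) * qPoch (-vq) vq (r + s) *
    ((qPoch (vq ^ 2) (vq ^ 2) r)⁻¹ * (qPoch (vq ^ 2) (vq ^ 2) s)⁻¹ * (qPoch vq vq t)⁻¹)

theorem closedForm_succ_a (r s t : ℕ) :
    (1 - vq ^ (2 * r + 2)) * vq ^ s * closedForm (r + 1) s t =
      vq ^ (r + 1) * (1 + vq ^ (r + s + 1)) * (vd + vq ^ (r + s + t + 1)) * va *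
        closedForm r s t := by
  have h := one_sub_mul_inv_qPoch_succ (x := vq ^ 2) (by simp [constantCoeff_vq]) (vq ^ 2) r
  have he : vq ^ expo (r + 1) s * vq ^ s = vq ^ expo r s * vq ^ (r + 1) := by
    rw [← pow_add, expo_succ, pow_add]
  unfold closedForm
  rw [show r + 1 + s + t = (r + s + t) + 1 by ring, show r + 1 + s = (r + s) + 1 by ring,
    qPochHom_succ, qPoch_succ, ← h]
  linear_combination (1 - vq ^ 2 * (vq ^ 2) ^ r) * (va ^ (r + 1) * vb ^ s *
    (qPochHom vd (-vq) vq (r + s + t) * (vd - -vq * vq ^ (r + s + t))) *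
    (qPoch (-vq) vq (r + s) * (1 - -vq * vq ^ (r + s))) *
    ((qPoch (vq ^ 2) (vq ^ 2) (r + 1))⁻¹ * (qPoch (vq ^ 2) (vq ^ 2) s)⁻¹ * (qPoch vq vq t)⁻¹)) * he

theorem closedForm_succ_b (r s t : ℕ) :
    (1 - vq ^ (2 * s + 2)) * vq ^ r * closedForm r (s + 1) t =
      vq ^ (s + 1) * (1 + vq ^ (r + s + 1)) * (vd + vq ^ (r + s + t + 1)) * vb *
        closedForm r s t := by
  have h := one_sub_mul_inv_qPoch_succ (x := vq ^ 2) (by simp [constantCoeff_vq]) (vq ^ 2) s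
  have he : vq ^ expo r (s + 1) * vq ^ r = vq ^ expo r s * vq ^ (s + 1) := by
    rw [← pow_add, expo_comm r (s + 1), expo_succ, pow_add, expo_comm]
  unfold closedForm
  rw [show r + (s + 1) + t = (r + s + t) + 1 by ring, show r + (s + 1) = (r + s) + 1 by ring,
    qPochHom_succ, qPoch_succ, ← h]
  linear_combination (1 - vq ^ 2 * (vq ^ 2) ^ s) * (va ^ r * vb ^ (s + 1) *
    (qPochHom vd (-vq) vq (r + s + t) * (vd - -vq * vq ^ (r + s + t))) *
    (qPoch (-vq) vq (r + s) * (1 - -vq * vq ^ (r + s))) *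
    ((qPoch (vq ^ 2) (vq ^ 2) r)⁻¹ * (qPoch (vq ^ 2) (vq ^ 2) (s + 1))⁻¹ * (qPoch vq vq t)⁻¹)) * he

theorem closedForm_succ_u (r s t : ℕ) :
    (1 - vq ^ (t + 1)) * closedForm r s (t + 1) =
      (vd + vq ^ (r + s + t + 1)) * closedForm r s t := by
  have h := one_sub_mul_inv_qPoch_succ constantCoeff_vq vq t
  unfold closedForm
  rw [show r + s + (t + 1) = (r + s + t) + 1 by ring, qPochHom_succ, ← h]
  ring

theorem closedForm_zero : closedForm 0 0 0 = 1 := by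
  have : (1 : Series)⁻¹ = 1 := by
    simp
  simp [closedForm, expo, qPochHom, qPoch, this]

theorem one_add_vq_pow_ne_zero (n : ℕ) : (1 + vq ^ n : Series) ≠ 0 := by
  intro h
  have := congrArg constantCoeff h
  rcases n with _ | n
  · rw [pow_zero, map_add, map_one, map_zero] at this
    norm_num at this
  · simp [constantCoeff_vq] at this

theorem one_sub_vq_pow_succ_ne_zero (n : ℕ) : (1 - vq ^ (n + 1) : Series) ≠ 0 := by
  intro h
  have := congrArg constantCoeff h
  simp [constantCoeff_vq] at this

theorem vq_pow_ne_zero (n : ℕ) : (vq ^ n : Series) ≠ 0 := by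
  refine pow_ne_zero _ fun h => ?_
  have := congrArg (MvPowerSeries.coeff (Finsupp.single Var.q 1)) h
  simp [vq, MvPowerSeries.coeff_index_single_self_X] at this

theorem eq_zero_of_total_eq_zero {c : Color → ℕ} (h : total c = 0) : c = 0 := by
  unfold total at h
  funext x
  cases x <;> simp <;> omega

theorem above_step_a_zero : above (step .a) 0 = {[]} := by
  ext l
  constructor
  · intro h
    have := length_of_mem_chains h.1
    simpa [total] using this
  · rintro rfl
    exact ⟨⟨List.isChain_nil, by simp⟩, by simp⟩

/-- The closed form evaluated at the numbers of parts of the three colors. -/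
noncomputable def closed (c : Color → ℕ) : Series := closedForm (c .a) (c .b) (c .u)

/-- The four generating functions attached to the color counts `c` in closed form. -/
structure ClosedForms (c : Color → ℕ) : Prop where
  above : gf (above (step .a) c) = closed c
  least_a : vq ^ c .a * (1 + vq ^ (c .a + c .b)) * leastGF .a c =
    (1 - vq ^ (2 * c .a)) * vq ^ c .b * closed c
  least_b : (1 + vq ^ (c .a + c .b)) * leastGF .b c = (1 - vq ^ (2 * c .b)) * closed c
  least_u : (1 + vq ^ (c .a + c .b)) * leastGF .u c =
    (1 - vq ^ c .u) * (vq ^ (c .a + c .b) + vq ^ (2 * c .b)) * closed c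

/-- The three `leastGF` formulas follow from smaller counts by deletion; only then does the lowering
relation yield the formula for `above`. -/
theorem closedForms (c : Color → ℕ) : ClosedForms c := by
  induction hN : total c generalizing c with
  | zero =>
    obtain rfl := eq_zero_of_total_eq_zero hN
    have h : ∀ x, leastGF x 0 = 0 := fun x => leastGF_eq_zero rfl
    refine ⟨?_, ?_, ?_, ?_⟩
    · rw [above_step_a_zero, gf_singleton_nil, closed]
      exact closedForm_zero.symm
    all_goals simp [h]
  | succ N ih =>
    have ha : vq ^ c .a * (1 + vq ^ (c .a + c .b)) * leastGF .a c =
        (1 - vq ^ (2 * c .a)) * vq ^ c .b * closed c := by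
      rcases eq_zero_or_eq_add_single c .a with h | ⟨c, rfl⟩
      · rw [leastGF_eq_zero h, h]
        simp
      · rw [total_add_single, add_left_inj] at hN
        have h := ih c hN
        have hs := closedForm_succ_a (c .a) (c .b) (c .u)
        rw [leastGF_add_single, colorTerm_a, h.above]
        simp only [closed, Pi.add_apply, Pi.single_eq_same, ne_eq, reduceCtorEq,
          not_false_eq_true, Pi.single_eq_of_ne, add_zero, total]
        linear_combination -hs
    have hb : (1 + vq ^ (c .a + c .b)) * leastGF .b c = (1 - vq ^ (2 * c .b)) * closed c := by
      rcases eq_zero_or_eq_add_single c .b with h | ⟨c, rfl⟩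
      · rw [leastGF_eq_zero h, h]
        simp
      · rw [total_add_single, add_left_inj] at hN
        have h := ih c hN
        have hs := closedForm_succ_b (c .a) (c .b) (c .u)
        refine mul_left_cancel₀ (mul_ne_zero (vq_pow_ne_zero (c .a))
          (one_add_vq_pow_ne_zero (c .a + c .b))) ?_
        -- For the smaller counts, `h₁` and `h₂` below amount to q^r (A + L_a - L_b) = q^s F once 1
        -- + q^(r+s) is cancelled.
        rw [leastGF_add_single, colorTerm_b, gf_above_step_b, h.above]
        have h₁ := h.least_a
        have h₂ := h.least_b
        simp only [closed, Pi.add_apply, Pi.single_eq_same, ne_eq, reduceCtorEq,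
          not_false_eq_true, Pi.single_eq_of_ne, add_zero, total] at h₁ h₂ ⊢
        linear_combination (1 + vq ^ (c .a + c .b + 1)) * (vd + vq ^ (c .a + c .b + c .u + 1)) *
          (vq * vb) * (h₁ - vq ^ c .a * h₂) - (1 + vq ^ (c .a + c .b)) * hs
    have hu : (1 + vq ^ (c .a + c .b)) * leastGF .u c =
        (1 - vq ^ c .u) * (vq ^ (c .a + c .b) + vq ^ (2 * c .b)) * closed c := by
      rcases eq_zero_or_eq_add_single c .u with h | ⟨c, rfl⟩
      · rw [leastGF_eq_zero h, h]
        simp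
      · rw [total_add_single, add_left_inj] at hN
        have h := ih c hN
        have hs := closedForm_succ_u (c .a) (c .b) (c .u)
        rw [leastGF_add_single, colorTerm_u, gf_above_step_u, h.above]
        have h₂ := h.least_b
        simp only [closed, Pi.add_apply, Pi.single_eq_same, ne_eq, reduceCtorEq,
          not_false_eq_true, Pi.single_eq_of_ne, add_zero, total] at h₂ ⊢
        linear_combination -(vd + vq ^ (c .a + c .b + c .u + 1)) * h₂ -
          (vq ^ (c .a + c .b) + vq ^ (2 * c .b)) * hs
    refine ⟨?_, ha, hb, hu⟩
    have h := gf_above_step_a c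
    -- In the lowering relation A has coefficient 1 - q^(N+1), with N + 1 the number of parts; the
    -- other factors clear the denominators of the `leastGF` formulas.
    refine mul_left_cancel₀ (mul_ne_zero (one_sub_vq_pow_succ_ne_zero N)
      (mul_ne_zero (vq_pow_ne_zero (c .a)) (one_add_vq_pow_ne_zero (c .a + c .b)))) ?_
    rw [← hN]
    have ht : vq ^ total c = vq ^ c .a * vq ^ c .b * vq ^ c .u := by
      rw [total, pow_add, pow_add]
    rw [ht] at h ⊢
    linear_combination -(vq ^ c .a * (1 + vq ^ (c .a + c .b))) * h +
      vq ^ c .a * hb + vq ^ c .a * hu + vq ^ c .a * vq ^ c .b * vq ^ c .u * ha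

theorem leastGF_u_eq (c : Color → ℕ) :
    leastGF .u c = (1 - vq ^ c .u) * (gf (above (step .a) c) - leastGF .b c) := by
  have h := closedForms c
  refine mul_left_cancel₀ (one_add_vq_pow_ne_zero (c .a + c .b)) ?_
  rw [h.above]
  linear_combination h.least_u + (1 - vq ^ c .u) * h.least_b

/-- Deleting the first part preserves tightness and swaps the roles of `a` and `b`. With L_u = (1 -
q^t)(A - L_b), the tight remainders sum to (1 - q^t) A after an `a` and to (1 - q^t)(A + L_a - L_b)
after a `b`. -/
theorem tightGF_eq (c : Color → ℕ) :
    tightGF .a c = (1 - vq ^ c .u) * leastGF .a c ∧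
      tightGF .b c = (1 - vq ^ c .u) * leastGF .b c := by
  induction hN : total c generalizing c with
  | zero =>
    obtain rfl := eq_zero_of_total_eq_zero hN
    simp [tightGF_eq_zero, leastGF_eq_zero]
  | succ N ih =>
    constructor
    · rcases eq_zero_or_eq_add_single c .a with h | ⟨c, rfl⟩
      · rw [leastGF_eq_zero h, tightGF_eq_zero h, mul_zero]
      · rw [total_add_single, add_left_inj] at hN
        rw [tightGF_add_single (by simp), leastGF_add_single, gf_tightAbove_a, (ih c hN).2,
          leastGF_u_eq]
        simp only [Pi.add_apply, ne_eq, reduceCtorEq, not_false_eq_true, Pi.single_eq_of_ne,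
          add_zero]
        ring
    · rcases eq_zero_or_eq_add_single c .b with h | ⟨c, rfl⟩
      · rw [leastGF_eq_zero h, tightGF_eq_zero h, mul_zero]
      · rw [total_add_single, add_left_inj] at hN
        rw [tightGF_add_single (by simp), leastGF_add_single, gf_tightAbove_b, (ih c hN).1,
          leastGF_u_eq, gf_above_step_b]
        simp only [Pi.add_apply, ne_eq, reduceCtorEq, not_false_eq_true, Pi.single_eq_of_ne,
          add_zero]
        ring

/-- The lists to discard start with a plain `b` or `u`; their L_b terms cancel and leave a multiple
of A. -/
theorem mul_gf_admissible (c : Color → ℕ) :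
    (vd + vq ^ total c) * gf (admissible c) =
      (vd + vq ^ total c - vd * (1 - vq ^ c .u)) * closed c := by
  have h₁ := gf_above_eq_admissible_add c
  have h₂ := gf_tightStarting_plain .b c
  have h₃ := gf_tightStarting_plain .u c
  have h₄ := leastGF_u_eq c
  rw [(tightGF_eq c).2] at h₂
  rw [tightGF_u] at h₃
  rw [← (closedForms c).above]
  linear_combination -(vd + vq ^ total c) * h₁ - h₂ - h₃ - vd * h₄

end Capparelli

/-! ### The q-binomial theorem and the sum over the number of `u`-parts -/

namespace Capparelli

open MvPowerSeries (constantCoeff)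
open Filter Topology

theorem tendsto_order_of_le {f : ℕ → Series} (h : ∀ i : ℕ, (i : ℕ∞) ≤ (f i).order) :
    Tendsto (fun i => (f i).order) atTop (𝓝 ⊤) := by
  simp_rw [ENat.tendsto_nhds_top_iff_natCast_lt, eventually_atTop]
  exact fun n => ⟨n + 1, fun m hm => lt_of_lt_of_le (by exact_mod_cast hm) (h m)⟩

theorem le_order_vq_pow (n : ℕ) : (n : ℕ∞) ≤ (vq ^ n).order :=
  MvPowerSeries.le_order_pow_of_constantCoeff_eq_zero n constantCoeff_vq

theorem multipliable_one_sub_mul_vq_pow (x : Series) :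
    Multipliable fun m : ℕ => 1 - x * vq ^ m := by
  have h := MvPowerSeries.WithPiTopology.multipliable_one_add_of_tendsto_order_atTop_nhds_top
    (tendsto_order_of_le (f := fun m => -(x * vq ^ m)) fun i => ?_)
  · simpa only [← sub_eq_add_neg] using h
  · rw [MvPowerSeries.order_neg]
    exact (le_order_vq_pow i).trans (le_add_self.trans MvPowerSeries.le_order_mul)

/-- The coefficients of the `q`-binomial series. -/
noncomputable def qBinom (x : Series) (t : ℕ) : Series :=
  qPochHom vd x vq t * (qPoch vq vq t)⁻¹

theorem le_order_qBinom {x : Series} (hx : constantCoeff x = 0) (t : ℕ) :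
    (t : ℕ∞) ≤ (qBinom x t).order := by
  refine le_trans (le_trans ?_ (MvPowerSeries.le_order_prod _ _))
    (le_self_add.trans MvPowerSeries.le_order_mul)
  have : ∀ m ∈ Finset.range t, 1 ≤ (vd - x * vq ^ m).order := fun m _ => by
    rw [MvPowerSeries.one_le_order_iff_constCoeff_eq_zero]
    simp [constantCoeff_vd, hx]
  simpa using Finset.sum_le_sum this

theorem qBinom_succ (x : Series) (t : ℕ) :
    (1 - vq ^ (t + 1)) * qBinom x (t + 1) = (vd - x * vq ^ t) * qBinom x t := by
  have h := one_sub_mul_inv_qPoch_succ constantCoeff_vq vq t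
  rw [qBinom, qBinom, qPochHom_succ, ← h]
  ring

theorem summable_qBinom {x : Series} (hx : constantCoeff x = 0) (k : ℕ) :
    Summable fun t => vq ^ (k * t) * qBinom x t := by
  refine MvPowerSeries.WithPiTopology.summable_of_tendsto_order_atTop_nhds_top
    (tendsto_order_of_le fun t => ?_)
  exact (le_order_qBinom hx t).trans (le_add_self.trans MvPowerSeries.le_order_mul)

/-- Subtracting the series for k and k + 1 produces the factor 1 - q^t, which `qBinom_succ` absorbs.
Iterating and letting k tend to infinity proves the q-binomial theorem. -/
theorem tsum_qBinom_rec {x : Series} (hx : constantCoeff x = 0) (k : ℕ) :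
    (1 - vd * vq ^ k) * ∑' t, vq ^ (k * t) * qBinom x t =
      (1 - x * vq ^ k) * ∑' t, vq ^ ((k + 1) * t) * qBinom x t := by
  have h₀ := summable_qBinom hx k
  have h₁ := summable_qBinom hx (k + 1)
  have h : ∑' t, (vq ^ (k * t) * qBinom x t - vq ^ ((k + 1) * t) * qBinom x t) =
      ∑' t, (vd * vq ^ k * (vq ^ (k * t) * qBinom x t) -
        x * vq ^ k * (vq ^ ((k + 1) * t) * qBinom x t)) := by
    rw [(h₀.sub h₁).tsum_eq_zero_add]
    simp only [mul_zero, pow_zero, sub_self, zero_add]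
    refine tsum_congr fun t => ?_
    linear_combination vq ^ (k * (t + 1)) * qBinom_succ x t
  rw [h₀.tsum_sub h₁, (h₀.mul_left _).tsum_sub (h₁.mul_left _), h₀.tsum_mul_left,
    h₁.tsum_mul_left] at h
  linear_combination h

theorem prod_mul_tsum_qBinom {x : Series} (hx : constantCoeff x = 0) (k : ℕ) :
    (∏ m ∈ Finset.range k, (1 - vd * vq ^ m)) * ∑' t, qBinom x t =
      (∏ m ∈ Finset.range k, (1 - x * vq ^ m)) * ∑' t, vq ^ (k * t) * qBinom x t := by
  induction k with
  | zero => simp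
  | succ k ih =>
    rw [Finset.prod_range_succ, Finset.prod_range_succ]
    linear_combination (1 - vd * vq ^ k) * ih +
      (∏ m ∈ Finset.range k, (1 - x * vq ^ m)) * tsum_qBinom_rec hx k

theorem tendsto_tsum_qBinom {x : Series} (hx : constantCoeff x = 0) :
    Tendsto (fun k : ℕ => ∑' t, vq ^ (k * t) * qBinom x t) atTop (𝓝 1) := by
  have hs := summable_qBinom hx
  have h : ∀ k : ℕ, ∑' t, vq ^ (k * t) * qBinom x t =
      1 + vq ^ k * ∑' t, vq ^ (k * t) * qBinom x (t + 1) := by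
    intro k
    have hs' : Summable fun t => vq ^ (k * t) * qBinom x (t + 1) := by
      refine MvPowerSeries.WithPiTopology.summable_of_tendsto_order_atTop_nhds_top
        (tendsto_order_of_le fun t => ?_)
      refine le_trans ?_ ((le_order_qBinom hx (t + 1)).trans
        (le_add_self.trans MvPowerSeries.le_order_mul))
      exact_mod_cast Nat.le_succ t
    rw [(hs k).tsum_eq_zero_add, ← hs'.tsum_mul_left]
    congr 1
    · simp [qBinom, qPochHom, qPoch]
    · exact tsum_congr fun t => by ring
  rw [MvPowerSeries.WithPiTopology.tendsto_iff_coeff_tendsto]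
  intro e
  refine tendsto_const_nhds.congr' ?_
  filter_upwards [eventually_gt_atTop e.degree] with k hk
  rw [h, map_add, MvPowerSeries.coeff_of_lt_order (f := vq ^ k * _), add_zero]
  refine lt_of_lt_of_le ?_ (((le_order_vq_pow k).trans le_self_add).trans
    MvPowerSeries.le_order_mul)
  exact_mod_cast hk

theorem tendsto_prod_qPochInf (x : Series) :
    Tendsto (fun k => ∏ m ∈ Finset.range k, (1 - x * vq ^ m)) atTop (𝓝 (qPochInf x vq)) :=
  (multipliable_one_sub_mul_vq_pow x).tendsto_prod_tprod_nat

/-- The `q`-binomial theorem. -/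
theorem qPochInf_mul_tsum_qBinom {x : Series} (hx : constantCoeff x = 0) :
    qPochInf vd vq * ∑' t, qBinom x t = qPochInf x vq := by
  refine tendsto_nhds_unique ((tendsto_prod_qPochInf vd).mul_const (∑' t, qBinom x t)) ?_
  simp_rw [prod_mul_tsum_qBinom hx]
  simpa using (tendsto_prod_qPochInf x).mul (tendsto_tsum_qBinom hx)

theorem qPoch_mul_qPochInf (x : Series) (n : ℕ) :
    qPoch x vq n * qPochInf (x * vq ^ n) vq = qPochInf x vq := by
  refine tendsto_nhds_unique ((tendsto_prod_qPochInf (x * vq ^ n)).const_mul (qPoch x vq n)) ?_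
  refine ((tendsto_add_atTop_iff_nat n).2 (tendsto_prod_qPochInf x)).congr fun k => ?_
  rw [add_comm k n, Finset.prod_range_add, qPoch]
  congr 1
  exact Finset.prod_congr rfl fun m _ => by rw [pow_add, mul_assoc]

theorem constantCoeff_qPochInf {x : Series} (hx : constantCoeff x = 0) :
    constantCoeff (qPochInf x vq) = 1 := by
  have hc : Continuous (constantCoeff (σ := Var) (R := ℚ)) := by
    apply MvPowerSeries.WithPiTopology.continuous_constantCoeff
  refine tendsto_nhds_unique ((hc.tendsto
    (qPochInf x vq)).comp (tendsto_prod_qPochInf x)) ?_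
  refine tendsto_const_nhds.congr fun k => ?_
  exact (constantCoeff_qPoch hx vq k).symm

theorem closedForm_eq (r s t : ℕ) :
    closedForm r s t =
      term r s * qPoch (-vq) vq (r + s) * qBinom (-vq * vq ^ (r + s)) t := by
  have h : qPochHom vd (-vq) vq (r + s + t) =
      qPochHom vd (-vq) vq (r + s) * qPochHom vd (-vq * vq ^ (r + s)) vq t := by
    rw [qPochHom, Finset.prod_range_add]
    congr 1
    exact Finset.prod_congr rfl fun m _ => by rw [pow_add, mul_assoc]
  rw [closedForm, term, qBinom, h, MvPowerSeries.mul_inv_rev, expo]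
  ring

theorem hasSum_closedForm (r s : ℕ) :
    HasSum (closedForm r s)
      (term r s * qPoch (-vq) vq (r + s) * ∑' t, qBinom (-vq * vq ^ (r + s)) t) := by
  have h : Summable (qBinom (-vq * vq ^ (r + s))) := by
    simpa using summable_qBinom (x := -vq * vq ^ (r + s)) (by simp [constantCoeff_vq]) 0
  simpa only [← closedForm_eq] using h.hasSum.mul_left (term r s * qPoch (-vq) vq (r + s))

/-- The color counts as a function. -/
def counts (r s t : ℕ) : Color → ℕ
  | .a => r
  | .b => s
  | .u => t

theorem vd_add_vq_pow_ne_zero (n : ℕ) : (vd + vq ^ n : Series) ≠ 0 := by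
  intro h
  have := congrArg (MvPowerSeries.coeff (Finsupp.single Var.d 1)) h
  rw [vd, vq, map_add, MvPowerSeries.coeff_index_single_self_X, MvPowerSeries.coeff_X_pow,
    if_neg, map_zero] at this
  · norm_num at this
  · intro h'
    have := DFunLike.congr_fun h' Var.d
    simp at this

theorem gf_admissible_zero (r s : ℕ) : gf (admissible (counts r s 0)) = closedForm r s 0 := by
  refine mul_left_cancel₀ (vd_add_vq_pow_ne_zero (total (counts r s 0))) ?_
  rw [mul_gf_admissible, closed]
  simp [counts]

theorem gf_admissible_succ (r s t : ℕ) :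
    gf (admissible (counts r s (t + 1))) = closedForm r s (t + 1) - vd * closedForm r s t := by
  refine mul_left_cancel₀ (vd_add_vq_pow_ne_zero (total (counts r s (t + 1)))) ?_
  rw [mul_gf_admissible, closed]
  have h := closedForm_succ_u r s t
  simp only [counts, total]
  linear_combination -vd * h

theorem hasSum_gf_admissible (r s : ℕ) :
    HasSum (fun t => gf (admissible (counts r s t)))
      (qPochInf (-vq) vq * (qPochInf (vd * vq) vq)⁻¹ * term r s) := by
  have h := hasSum_closedForm r s
  have hx : constantCoeff (-vq * vq ^ (r + s)) = 0 := by simp [constantCoeff_vq]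
  have hinv := MvPowerSeries.mul_inv_cancel (qPochInf (vd * vq) vq)
    (by rw [constantCoeff_qPochInf (by simp [constantCoeff_vq])]; exact one_ne_zero)
  have h₁ := qPochInf_mul_tsum_qBinom hx
  have h₂ := qPoch_mul_qPochInf (-vq) (r + s)
  -- This is (d)_∞ = (1 - d)(dq)_∞.
  have h₃ := qPoch_mul_qPochInf vd 1
  simp only [qPoch, Finset.prod_range_one, pow_zero, mul_one, pow_one] at h₃
  -- The term t = 0 is split off because nothing is subtracted from it.
  rw [← hasSum_nat_add_iff' 1] at h ⊢
  have h' := (hasSum_closedForm r s).mul_left vd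
  convert h.sub h' using 1
  · funext t
    exact gf_admissible_succ r s t
  · simp only [Finset.sum_range_one, gf_admissible_zero]
    rw [← h₂, ← h₁, ← h₃]
    linear_combination (qPoch (-vq) vq (r + s) * (1 - vd) *
      (∑' t, qBinom (-vq * vq ^ (r + s)) t) * term r s) * hinv

end Capparelli

/-! ### Back from excesses to jagged overpartitions -/

namespace Capparelli

/-- The reversed jagged overpartitions to be counted, in terms of excesses. -/
def counted : Set (List Part) :=
  {l | l.IsChain Next ∧ (∀ p ∈ l.head?, step .a p.color ≤ p.size) ∧
    (Tight 0 l → ∀ p ∈ l.head?, p.overlined = true)}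

/-- A generating function is the sum over the classes of a partition of the set. -/
theorem hasSum_gf {ι : Type*} (S : Set (List Part)) (f : List Part → ι) :
    HasSum (fun i => gf {l ∈ S | f l = i}) (gf S) := by
  classical
  rw [MvPowerSeries.WithPiTopology.hasSum_iff_hasSum_coeff]
  intro e
  set F := (finite_fiber S e).toFinset with hF
  have hmem : ∀ l, l ∈ F ↔ l ∈ S ∧ weight l = e := fun l => by simp [hF]
  have h : ∀ i, MvPowerSeries.coeff e (gf {l ∈ S | f l = i}) = (F.filter (f · = i)).card := by
    intro i
    rw [coeff_gf, ← Set.ncard_coe_finset]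
    congr 2
    ext l
    simp only [Set.mem_ofPred_eq, Finset.coe_filter, hmem]
    tauto
  have hS : MvPowerSeries.coeff e (gf S) = F.card := by
    rw [coeff_gf, ← Set.ncard_coe_finset]
    congr 2
    ext l
    simp [hmem]
  simp only [h, hS]
  rw [Finset.card_eq_sum_card_image f F]
  push_cast
  apply hasSum_sum_of_ne_finset_zero
  intro i hi
  rw [Nat.cast_eq_zero, Finset.card_eq_zero, Finset.filter_eq_empty_iff]
  exact fun l hl hli => hi (Finset.mem_image.2 ⟨l, hl, hli⟩)

theorem admissible_eq (p : (ℕ × ℕ) × ℕ) :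
    admissible (counts p.1.1 p.1.2 p.2) =
      {l ∈ counted | ((l.countP (fun p => p.color = .a), l.countP (fun p => p.color = .b)),
        l.countP (fun p => p.color = .u)) = p} := by
  rcases p with ⟨⟨r, s⟩, t⟩
  ext l
  have : (∀ x, l.countP (fun p => p.color = x) = counts r s t x) ↔
      (l.countP (fun p => p.color = .a) = r ∧ l.countP (fun p => p.color = .b) = s) ∧
        l.countP (fun p => p.color = .u) = t := by
    refine ⟨fun h => ⟨⟨h .a, h .b⟩, h .u⟩, ?_⟩
    rintro ⟨⟨h₁, h₂⟩, h₃⟩ (_ | _ | _) <;> assumption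
  simp only [admissible, above, chains, counted, Set.mem_ofPred_eq, Prod.mk.injEq, this]
  tauto

theorem hasSum_term :
    HasSum (fun p : ℕ × ℕ => qPochInf (-vq) vq * (qPochInf (vd * vq) vq)⁻¹ * term p.1 p.2)
      (gf counted) := by
  have h := hasSum_gf counted fun l =>
    ((l.countP (fun p => p.color = .a), l.countP (fun p => p.color = .b)),
        l.countP (fun p => p.color = .u))
  simp only [← admissible_eq] at h
  exact h.prod_fiberwise fun p => hasSum_gf_admissible p.1 p.2

/-- The part with a given excess. -/
def Part.raise (p : Part) : Part :=
  { p with size := p.size + p.color.offset + p.overlined.toNat }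

theorem Part.raise_injective : Function.Injective Part.raise := by
  rintro ⟨n, x, o⟩ ⟨n', x', o'⟩ h
  simp only [Part.raise, Part.mk.injEq] at h
  obtain ⟨h, rfl, rfl⟩ := h
  simp_all

/-- The list of parts that is described by a reversed list of excesses. -/
def toParts (l : List Part) : List Part := (l.map Part.raise).reverse

theorem toParts_injective : Function.Injective toParts :=
  List.reverse_injective.comp (List.map_injective_iff.2 Part.raise_injective)

/-- The matrix entry in the row of y and the column of x is offset(y) - offset(x) + `step x y`, plus
1 if y is overlined. -/
theorem next_iff (x y : Part) :
    diffMatrix y.raise.index x.raise.index ≤ (y.raise.size : ℤ) - (x.raise.size : ℤ) ↔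
      Next x y := by
  rcases x with ⟨m, x, o⟩
  rcases y with ⟨n, y, o'⟩
  cases x <;> cases y <;> cases o <;> cases o' <;>
    simp [diffMatrix, Part.index, Part.raise, Color.offset, Next, step] <;> omega

theorem isChain_toParts (l : List Part) :
    (toParts l).IsChain (fun p p' => diffMatrix p.index p'.index ≤ (p.size : ℤ) - (p'.size : ℤ)) ↔
      l.IsChain Next := by
  rw [toParts, List.isChain_reverse, List.isChain_map]
  simp only [next_iff]

theorem getLast?_toParts (l : List Part) : (toParts l).getLast? = l.head?.map Part.raise := by
  rw [toParts, List.getLast?_reverse, List.head?_map]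

theorem isJagged_toParts (l : List Part) :
    IsJagged (toParts l) ↔ l.IsChain Next ∧ ∀ p ∈ l.head?, step .a p.color ≤ p.size := by
  have hlast : (∀ p ∈ (toParts l).getLast?, p ≠ ⟨0, Color.a, false⟩ ∧ p ≠ ⟨0, Color.b, false⟩ ∧
      p ≠ ⟨1, Color.a, true⟩ ∧ p ≠ ⟨1, Color.b, true⟩) ↔
      ∀ p ∈ l.head?, step .a p.color ≤ p.size := by
    rw [getLast?_toParts]
    cases l with
    | nil => simp
    | cons p l =>
      rcases p with ⟨n, x, o⟩
      cases x <;> cases o <;> simp [Part.raise, Color.offset, step] <;> omega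
  constructor
  · exact fun h => ⟨(isChain_toParts l).1 h.diff, hlast.1 h.last_ne⟩
  · rintro ⟨h₁, h₂⟩
    refine ⟨?_, ?_, hlast.2 h₂, (isChain_toParts l).2 h₁⟩
    · intro p hp ho
      simp only [toParts, List.mem_reverse, List.mem_map] at hp
      obtain ⟨p, _, rfl⟩ := hp
      rcases p with ⟨n, x, o⟩
      obtain rfl : o = true := ho
      simp [Part.raise]
    -- The rule on final occurrences is automatic: an overlined part is strictly larger than every
    -- later part of its color.
    · rw [toParts, List.pairwise_reverse, List.pairwise_map]
      refine (pairwise_of_isChain h₁).imp ?_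
      rintro ⟨m, x, o⟩ ⟨n, y, o'⟩ h ho
      obtain rfl : o' = true := ho
      rintro ⟨hs, hc⟩
      simp only [Part.raise] at h hs hc
      subst hc
      simp at hs
      omega

/-- The matrix propagates the least possible size from the last part to all others, so that
subtracting it in `exists_toParts_eq` never truncates. -/
theorem offset_le_size {l : List Part}
    (hc : l.IsChain fun x y => diffMatrix y.index x.index ≤ (y.size : ℤ) - (x.size : ℤ))
    (hh : ∀ p ∈ l.head?, p.color.offset + p.overlined.toNat ≤ p.size) :
    ∀ p ∈ l, p.color.offset + p.overlined.toNat ≤ p.size := by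
  induction l with
  | nil => simp
  | cons x l ih =>
    rw [List.isChain_cons] at hc
    have hx := hh x rfl
    refine List.forall_mem_cons.2 ⟨hx, ih hc.2 fun y hy => ?_⟩
    have hxy := hc.1 y hy
    rcases x with ⟨m, x, o⟩
    rcases y with ⟨n, y, o'⟩
    cases x <;> cases y <;> cases o <;> cases o' <;>
      simp [diffMatrix, Part.index, Color.offset] at hx hxy ⊢ <;> omega

theorem exists_toParts_eq {l : List Part} (h : IsJagged l) : ∃ l', toParts l' = l := by
  have hb : ∀ p ∈ l.reverse, p.color.offset + p.overlined.toNat ≤ p.size := by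
    refine offset_le_size (List.isChain_reverse.2 h.diff) fun p hp => ?_
    rw [List.head?_reverse] at hp
    have h₁ := h.last_ne p hp
    have h₂ := h.pos_of_overlined p (List.mem_of_getLast? hp)
    rcases p with ⟨n, x, o⟩
    cases x <;> cases o <;> simp [Color.offset] at h₁ h₂ ⊢ <;> omega
  refine ⟨l.reverse.map fun p => { p with size := p.size - (p.color.offset + p.overlined.toNat) },
    ?_⟩
  rw [toParts, List.map_map, List.reverse_eq_iff]
  refine (List.map_congr_left fun p hp => ?_).trans (List.map_id l.reverse)
  have := hb p hp
  rcases p with ⟨n, x, o⟩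
  simp only [Part.raise, Function.comp, id, Part.mk.injEq, and_true]
  simp only at this
  omega

theorem exists_of_tight {m : ℕ} {l : List Part} (h : Tight m l) :
    ∃ l₁ x l₂, l = l₁ ++ x :: l₂ ∧ x.color = .u ∧ (∀ y ∈ l₁, y.color ≠ .u) ∧
      x.size = m + l₁.countP (fun p => p.overlined) := by
  induction l generalizing m with
  | nil => exact h.elim
  | cons p l ih =>
    rw [Tight] at h
    split_ifs at h with hp
    · exact ⟨[], p, l, rfl, hp, by simp, by simpa using h⟩
    · obtain ⟨l₁, x, l₂, rfl, hx, hl₁, hs⟩ := ih h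
      refine ⟨p :: l₁, x, l₂, rfl, hx, List.forall_mem_cons.2 ⟨hp, hl₁⟩, ?_⟩
      rw [hs, List.countP_cons]
      cases p.overlined <;> simp
      omega

theorem tight_of_isChain {m : ℕ} {l₁ l₂ : List Part} {x : Part}
    (h : (l₁ ++ x :: l₂).IsChain Next) (hh : ∀ p ∈ (l₁ ++ x :: l₂).head?, m ≤ p.size)
    (hx : x.color = .u) (hs : x.size = m + l₁.countP (fun p => p.overlined)) :
    Tight m (l₁ ++ x :: l₂) := by
  induction l₁ generalizing m with
  | nil => simpa [Tight, hx] using hs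
  | cons p l₁ ih =>
    have hp : m ≤ p.size := hh p rfl
    rw [List.cons_append, List.isChain_cons] at h
    have hnext : ∀ y ∈ (l₁ ++ x :: l₂).head?, p.size + p.overlined.toNat ≤ y.size :=
      fun y hy => le_trans (Nat.le_add_right _ _) (h.1 y hy)
    have ht : Tight (m + p.overlined.toNat) (l₁ ++ x :: l₂) := by
      refine ih h.2 (fun y hy => le_trans (by omega) (hnext y hy)) ?_
      rw [hs, List.countP_cons]
      cases p.overlined <;> simp
      omega
    rw [List.cons_append, Tight]
    split_ifs
    -- If an earlier `u`-part had excess above `m`, the rest of the chain would be ahead as well and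
    -- could not be tight.
    · by_contra hne
      obtain ⟨y, l', hl'⟩ : ∃ y l', l₁ ++ x :: l₂ = y :: l' := List.exists_cons_of_ne_nil (by simp)
      rw [hl'] at ht h hnext
      have := hnext y rfl
      exact not_tight_of_lt h.2 (by omega) ht
    · exact ht

theorem countP_map_raise (l : List Part) :
    (l.map Part.raise).countP (fun p => p.overlined) = l.countP (fun p => p.overlined) := by
  rw [List.countP_map]
  rfl

theorem extraCondition_toParts {l : List Part} (h : l.IsChain Next) :
    ExtraCondition (toParts l) ↔ (Tight 0 l → ∀ p ∈ l.head?, p.overlined = true) := by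
  have hlast : (∀ p ∈ (toParts l).getLast?, p.overlined = true) ↔
      ∀ p ∈ l.head?, p.overlined = true := by
    rw [getLast?_toParts]
    cases l <;> simp [Part.raise]
  rw [← hlast]
  constructor
  · intro hE ht
    obtain ⟨l₁, x, l₂, rfl, hx, hl₁, hs⟩ := exists_of_tight ht
    have hpw := (List.pairwise_append.1 (pairwise_of_isChain h)).2.1
    refine hE (l₂.map Part.raise).reverse x.raise (l₁.map Part.raise).reverse (by simp [toParts])
      hx ?_ ?_
    · intro y hy hyu
      simp only [toParts, List.mem_reverse, List.mem_map] at hy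
      obtain ⟨z, hz, rfl⟩ := hy
      rcases List.mem_append.1 hz with hz | hz
      · exact absurd hyu (hl₁ z hz)
      · rcases List.mem_cons.1 hz with rfl | hz
        · exact le_rfl
        · have := List.rel_of_pairwise_cons hpw hz
          simp only [Part.raise, hx, Color.offset]
          omega
    · rw [List.countP_cons, List.countP_reverse, countP_map_raise]
      simp only [Part.raise, hx, Color.offset, hs]
      cases x.overlined <;> simp
  · intro hT l₁ x l₂ hl hx _ hs
    refine hT ?_
    rw [toParts, List.reverse_eq_iff, List.reverse_append, List.reverse_cons, List.append_assoc,
      List.map_eq_append_iff] at hl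
    obtain ⟨m₁, m₂, rfl, hm₁, hm₂⟩ := hl
    rw [List.singleton_append, List.map_eq_cons_iff] at hm₂
    obtain ⟨y, m₂, rfl, rfl, -⟩ := hm₂
    have hy : y.color = .u := hx
    refine tight_of_isChain h (fun _ _ => Nat.zero_le _) hy ?_
    rw [List.countP_cons, ← List.countP_reverse, ← hm₁, countP_map_raise] at hs
    simp only [Part.raise, hy, Color.offset] at hs
    revert hs
    cases y.overlined <;> simp

theorem weight_toParts (l : List Part) :
    ((toParts l).map Part.size).sum = weight l .q ∧
    (toParts l).countP (fun p => !p.overlined) = weight l .d ∧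
    (toParts l).countP (fun p => p.color = Color.a) = weight l .a ∧
    (toParts l).countP (fun p => p.color = Color.b) = weight l .b := by
  induction l with
  | nil => simp [toParts]
  | cons p l ih =>
    have h : toParts (p :: l) = toParts l ++ [p.raise] := by simp [toParts]
    obtain ⟨h₁, h₂, h₃, h₄⟩ := ih
    simp only [h, List.map_append, List.sum_append, List.countP_append, h₁, h₂, h₃, h₄,
      weight_cons, Finsupp.add_apply]
    rcases p with ⟨n, x, o⟩
    cases x <;> cases o <;>
      simp [Part.raise, Part.weight, Color.weight, Color.offset] <;> omega

theorem C1Set_eq_image (e : Var →₀ ℕ) :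
    C1Set (e .q) (e .d) (e .a) (e .b) = toParts '' {l ∈ counted | weight l = e} := by
  ext l
  constructor
  · rintro ⟨hJ, hE, h₁, h₂, h₃, h₄⟩
    obtain ⟨l, rfl⟩ := exists_toParts_eq hJ
    obtain ⟨hc, hh⟩ := (isJagged_toParts l).1 hJ
    obtain ⟨w₁, w₂, w₃, w₄⟩ := weight_toParts l
    refine ⟨l, ⟨⟨hc, hh, (extraCondition_toParts hc).1 hE⟩, ?_⟩, rfl⟩
    ext v
    cases v
    · exact w₃.symm.trans h₃
    · exact w₄.symm.trans h₄
    · exact w₂.symm.trans h₂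
    · exact w₁.symm.trans h₁
  · rintro ⟨l, ⟨⟨hc, hh, hE⟩, rfl⟩, rfl⟩
    exact ⟨(isJagged_toParts l).2 ⟨hc, hh⟩, (extraCondition_toParts hc).2 hE, weight_toParts l⟩

theorem C1Set_finite (n k i j : ℕ) : (C1Set n k i j).Finite := by
  have h := C1Set_eq_image (Finsupp.single .q n + Finsupp.single .d k + Finsupp.single .a i +
    Finsupp.single .b j)
  simp only [Finsupp.add_apply, Finsupp.single_apply] at h
  simp only [reduceCtorEq, if_true, if_false, add_zero, zero_add] at h
  rw [h]
  exact (finite_fiber _ _).image _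

theorem C1Series_eq_gf : C1Series = gf counted := by
  funext e
  rw [C1Series, gf, C1, C1Set_eq_image, Set.ncard_image_of_injective _ toParts_injective]

end Capparelli

open Capparelli in
theorem mainTheorem1 :
    (∀ n k i j : ℕ, (C1Set n k i j).Finite) ∧
    Multipliable (fun m : ℕ => 1 - (-vq) * vq ^ m) ∧
    Multipliable (fun m : ℕ => 1 - (vd * vq) * vq ^ m) ∧
    Summable (fun p : ℕ × ℕ => term p.1 p.2) ∧
    C1Series =
      qPochInf (-vq) vq * (qPochInf (vd * vq) vq)⁻¹ * ∑' p : ℕ × ℕ, term p.1 p.2 := by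
  have h₁ : qPochInf (-vq) vq * (qPochInf (-vq) vq)⁻¹ = 1 := MvPowerSeries.mul_inv_cancel _
    (by rw [constantCoeff_qPochInf (by simp [constantCoeff_vq])]; exact one_ne_zero)
  have h₂ : qPochInf (vd * vq) vq * (qPochInf (vd * vq) vq)⁻¹ = 1 := MvPowerSeries.mul_inv_cancel _
    (by rw [constantCoeff_qPochInf (by simp [constantCoeff_vq])]; exact one_ne_zero)
  -- `hasSum_term` carries the prefactor (-q)_∞/(dq)_∞, which is a unit and can be divided out.
  have hs : Summable (fun p : ℕ × ℕ => term p.1 p.2) := by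
    refine (hasSum_term.summable.mul_left (qPochInf (vd * vq) vq * (qPochInf (-vq) vq)⁻¹)).congr
      fun p => ?_
    linear_combination (qPochInf (-vq) vq * (qPochInf (-vq) vq)⁻¹ * term p.1 p.2) * h₂ +
      term p.1 p.2 * h₁
  refine ⟨C1Set_finite, multipliable_one_sub_mul_vq_pow _, multipliable_one_sub_mul_vq_pow _,
    hs, ?_⟩
  rw [C1Series_eq_gf]
  exact hasSum_term.unique (hs.hasSum.mul_left _)
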